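/- Theorem 4.1 (Invariance Theorem). Let $N\in\mathbb N$, $T>0$, let $|\cdot|$ be the Euclidean norm on $\mathbb R^N$ and $B_R=\{x\in\mathbb R^N: |x|\le R\}$. For $\varphi$ with values in $[-\infty,+\infty]$ put $\operatorname{dom}\varphi=\{z:\varphi(z)\ne\pm\infty\}$ and $\operatorname{epi}\varphi=\{(z,r): r\in\mathbb R,\ \varphi(z)\le r\}$; $\varphi$ is proper if it never takes the value $-\infty$ and is not identically $+\infty$. Let $L:[0,T]\times\mathbb R^N\times\mathbb R^N\to[-\infty,+\infty]$ satisfy: (L1) $L$ is lower semicontinuous in all variables; (L2) $L(t,x,\cdot)$ is convex and proper for every $(t,x)\in[0,T]\times\mathbb R^N$; (L3) for all $(t,x,v)\in[0,T]\times\mathbb R^N\times\mathbb R^N$ and every sequence $(t_k,x_k)\to(t,x)$ in $[0,T]\times\mathbb R^N$ there are $v_k\to v$ with $L(t_k,x_k,v_k)\to L(t,x,v)$; (L4) for every $R\ge 0$ there is $C_R\ge 0$ such that $L(t,x,v)=+\infty$ for all $t\in[0,T]$, $x\in B_R$ and $v\in\mathbb R^N$ with $|v|>C_R$; (L5) there is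 an integrable $c:[0,T]\to[0,+\infty)$ such that for almost all $t\in[0,T]$ and all $x,v\in\mathbb R^N$ with $|v|>c(t)(1+|x|)$ one has $L(t,x,v)=+\infty$; (L6) for every $R\ge 0$ there is an integrable $k_R:[0,T]\to[0,+\infty)$ such that for almost all $t\in[0,T]$, all $x,y\in B_R$ and all $v\in\operatorname{dom}L(t,x,\cdot)$ there is $w\in\operatorname{dom}L(t,y,\cdot)$ with $|w-v|\le k_R(t)|y-x|$ and $L(t,y,w)\le L(t,x,v)+k_R(t)|y-x|$. Define $Q(t,x)=\{(v,\eta)\in\mathbb R^N\times\mathbb R : (v,-\eta)\in\operatorname{epi}L(t,x,\cdot)\}$. For $E\subset\mathbb R^M$ and $w\in E$ let $$T_E(w)=\Big\{\zeta\in\mathbb R^M:\ \liminf_{\tau\to0+}\frac{\operatorname{dist}(w+\tau\zeta,E)}{\tau}=0\Big\},\qquad N_E(w)=\{\xi\in\mathbb R^M:\ \langle\zeta,\xi\rangle\le0\ \text{ for all }\zeta\in T_E(w)\}.$$ Let $U:[0,T]\times\mathbb R^N\to[-\infty,+\infty]$ be proper and lower semicontinuous, and regard $\operatorname{epi}U$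 as a subset of $\mathbb R\times\mathbb R^N\times\mathbb R$. Assume that for every $(t,x)\in\operatorname{dom}U$ with $t\in(0,T]$, every $(n^t,n^x,n^u)\in N_{\operatorname{epi}U}(t,x,U(t,x))$ and every $v\in\operatorname{dom}L(t,x,\cdot)$, $$n^t+\langle v,n^x\rangle-n^uL(t,x,v)\ \ge\ 0 .$$ Then for every $t_0\in[0,T)$ and every absolutely continuous $(x,u):[t_0,T]\to\mathbb R^N\times\mathbb R$ satisfying $(\dot x(t),\dot u(t))\in Q(t,x(t))$ for almost every $t\in[t_0,T]$ and $u(T)\ge U(T,x(T))$, one has $u(t)\ge U(t,x(t))$ for all $t\in[t_0,T]$. -/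

import Mathlib

open MeasureTheory Filter Topology

/-- The Euclidean space `ℝⁿ`. -/
abbrev RN (n : ℕ) : Type := EuclideanSpace ℝ (Fin n)

/-- The Euclidean space `ℝ × ℝⁿ × ℝ = ℝ^(1+n+1)` of triples `(t, x, u)`, with its `ℓ²` structure. -/
abbrev TimeStateValue (n : ℕ) : Type := WithLp 2 (ℝ × WithLp 2 (RN n × ℝ))

/-- The point `(t, x, u)` of `ℝ × ℝⁿ × ℝ`. -/
def triple {n : ℕ} (t : ℝ) (x : RN n) (u : ℝ) : TimeStateValue n :=
  WithLp.toLp 2 (t, WithLp.toLp 2 (x, u))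

/-- The effective domain of an extended real-valued function: the set of points where it is
finite. -/
def effDom {X : Type*} (φ : X → EReal) : Set X := {z | φ z ≠ ⊤ ∧ φ z ≠ ⊥}

/-- The epigraph of an extended real-valued function. -/
def epigraph {X : Type*} (φ : X → EReal) : Set (X × ℝ) := {p | φ p.1 ≤ (p.2 : EReal)}

/-- A function is proper on `s` if it never takes the value `-∞` on `s` and is not identically
`+∞` on `s`. -/
def ProperOn {X : Type*} (φ : X → EReal) (s : Set X) : Prop :=
  (∀ z ∈ s, φ z ≠ ⊥) ∧ ∃ z ∈ s, φ z ≠ ⊤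

/-- The (Bouligand) tangent cone to `E` at `w`: all `ζ` such that
`liminf_{τ → 0+} dist (w + τ ζ, E) / τ = 0`. -/
def tangentCone {V : Type*} [NormedAddCommGroup V] [NormedSpace ℝ V] (E : Set V) (w : V) : Set V :=
  {ζ | liminf (fun τ : ℝ => Metric.infEDist (w + τ • ζ) E / ENNReal.ofReal τ) (𝓝[>] 0) = 0}

/-- The normal cone to `E` at `w`: the polar of the tangent cone. -/
def normalCone {V : Type*} [NormedAddCommGroup V] [InnerProductSpace ℝ V] (E : Set V) (w : V) :
    Set V :=
  {ξ | ∀ ζ ∈ tangentCone E w, inner ℝ ζ ξ ≤ 0}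

/-! ### Conditions on the Lagrangian

A function on `[0,T] × ℝⁿ × ⋯` is a function of all real times of which only the values at times
in `[0,T]` are ever used. -/

/-- `L` is lower semicontinuous on `[0,T] × ℝⁿ × ℝⁿ` with respect to all variables. -/
def LagrangianLSC {n : ℕ} (T : ℝ) (L : ℝ → RN n → RN n → EReal) : Prop :=
  LowerSemicontinuousOn (fun p : ℝ × RN n × RN n => L p.1 p.2.1 p.2.2)
    (Set.Icc 0 T ×ˢ Set.univ)

/-- `L(t,x,·)` is convex and proper. -/
def LagrangianConvexProper {n : ℕ} (T : ℝ) (L : ℝ → RN n → RN n → EReal) : Prop :=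
  ∀ t ∈ Set.Icc 0 T, ∀ x : RN n,
    Convex ℝ (epigraph (L t x)) ∧ ProperOn (L t x) Set.univ

/-- For all `(t,x,v)` and all `(tₖ,xₖ) → (t,x)` there are `vₖ → v` with
`L(tₖ,xₖ,vₖ) → L(t,x,v)`. -/
def LagrangianRecovery {n : ℕ} (T : ℝ) (L : ℝ → RN n → RN n → EReal) : Prop :=
  ∀ t ∈ Set.Icc 0 T, ∀ x v : RN n, ∀ (tk : ℕ → ℝ) (xk : ℕ → RN n),
    (∀ k, tk k ∈ Set.Icc 0 T) → Tendsto tk atTop (𝓝 t) → Tendsto xk atTop (𝓝 x) →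
      ∃ vk : ℕ → RN n, Tendsto vk atTop (𝓝 v) ∧
        Tendsto (fun k => L (tk k) (xk k) (vk k)) atTop (𝓝 (L t x v))

/-- The domains of `L(t,x,·)` are bounded, uniformly for `t ∈ [0,T]` and `x` in a ball. -/
def LagrangianLocallyBoundedDom {n : ℕ} (T : ℝ) (L : ℝ → RN n → RN n → EReal) : Prop :=
  ∀ R : ℝ, 0 ≤ R → ∃ C : ℝ, 0 ≤ C ∧
    ∀ t ∈ Set.Icc 0 T, ∀ x ∈ Metric.closedBall (0 : RN n) R, ∀ v : RN n,
      C < ‖v‖ → L t x v = ⊤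

/-- The domains of `L(t,x,·)` grow at most linearly in `x`, with an integrable rate in `t`. -/
def LagrangianLinearGrowthDom {n : ℕ} (T : ℝ) (L : ℝ → RN n → RN n → EReal) : Prop :=
  ∃ c : ℝ → ℝ, IntegrableOn c (Set.Icc 0 T) ∧ (∀ t ∈ Set.Icc 0 T, 0 ≤ c t) ∧
    ∀ᵐ t ∂(volume.restrict (Set.Icc 0 T)), ∀ x v : RN n,
      c t * (1 + ‖x‖) < ‖v‖ → L t x v = ⊤

/-- Lipschitz dependence on the state: for every `R ≥ 0` there is an integrable `k ≥ 0` such that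
for a.e. `t ∈ [0,T]`, all `x, y` in the closed ball of radius `R` and every `v ∈ dom L(t,x,·)`
there is `w ∈ dom L(t,y,·)` with `|w - v| ≤ k(t)|y - x|` and
`L(t,y,w) ≤ L(t,x,v) + k(t)|y - x|`. -/
def LagrangianLipschitz {n : ℕ} (T : ℝ) (L : ℝ → RN n → RN n → EReal) : Prop :=
  ∀ R : ℝ, 0 ≤ R →
    ∃ k : ℝ → ℝ, IntegrableOn k (Set.Icc 0 T) ∧ (∀ t ∈ Set.Icc 0 T, 0 ≤ k t) ∧
      ∀ᵐ t ∂(volume.restrict (Set.Icc 0 T)),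
        ∀ x ∈ Metric.closedBall (0 : RN n) R, ∀ y ∈ Metric.closedBall (0 : RN n) R,
          ∀ v ∈ effDom (L t x), ∃ w ∈ effDom (L t y),
            ‖w - v‖ ≤ k t * ‖y - x‖ ∧
            L t y w ≤ L t x v + ((k t * ‖y - x‖ : ℝ) : EReal)

/-- The set-valued map `Q(t,x) = {(v,η) | (v,-η) ∈ epi L(t,x,·)}`. -/
def lagrangianQ {n : ℕ} (L : ℝ → RN n → RN n → EReal) (t : ℝ) (x : RN n) : Set (RN n × ℝ) :=
  {p | (p.1, -p.2) ∈ epigraph (L t x)}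

/-! ### The function `U` on `[0,T] × ℝⁿ` -/

/-- The epigraph of `U : [0,T] × ℝⁿ → [-∞,∞]`, as a subset of `ℝ × ℝⁿ × ℝ`. -/
def timeEpigraph {n : ℕ} (T : ℝ) (U : ℝ → RN n → EReal) : Set (TimeStateValue n) :=
  {p | ∃ t ∈ Set.Icc 0 T, ∃ (x : RN n) (u : ℝ), U t x ≤ (u : EReal) ∧ p = triple t x u}

/-- The normal inequality: at every `(t,x)` with `t ∈ (0,T]` at which `U` is finite, say
`U(t,x) = r`, every normal `(nt,nx,nu)` to the epigraph of `U` at `(t,x,r)` and every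
`v ∈ dom L(t,x,·)`, say `L(t,x,v) = l`, satisfy `nt + ⟨v,nx⟩ - nu * l ≥ 0`. -/
def NormalInequality {n : ℕ} (T : ℝ) (L : ℝ → RN n → RN n → EReal) (U : ℝ → RN n → EReal) :
    Prop :=
  ∀ t ∈ Set.Ioc 0 T, ∀ (x : RN n) (r : ℝ), U t x = (r : EReal) →
    ∀ (nt : ℝ) (nx : RN n) (nu : ℝ),
      triple nt nx nu ∈ normalCone (timeEpigraph T U) (triple t x r) →
      ∀ (v : RN n) (l : ℝ), L t x v = (l : EReal) →
        0 ≤ nt + inner ℝ v nx - nu * l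

/-!
The statement is a strong invariance property of the closed set `K = epi U`, proved by an Euler
scheme run backward from time `T` whose velocities are chosen by proximal aiming.

Let `Z = (x, u)` be the given trajectory, with derivative `Z'` (represented coordinatewise by
`deriv`), and let `g` be a continuous function close to `Z'` in `L¹`. From a point `(t, z)`, take a
point `p = (s, y, r)` of `K` nearest to it, take for `f` the point of `Q(s, y)` nearest to `g(s)`,
and move to `(t - h, z - h f)`.

* *The scheme stays near `K`.* The vector `(t, z) - p` is a proximal normal to `K`. Upward
  translations map `K` into itself, so it is also a proximal normal at the point of the graph
  of `U` below `p`, where the normal inequality applies (`inner_sub_triple_nonneg`): the step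
  direction `-(1, f)` makes a nonpositive inner product with it. Hence the squared distance to `K`
  grows by at most `h² |(1, f)|²` in a step (`infDist_sub_smul_sq_le`), and by `O(h)` in total.
* *The scheme stays near `Z`.* The map `Q` has a closed graph (L1) and is lower semicontinuous (L3),
  so `(t, x) ↦ dist (g(t), Q(t, x))` is continuous (`continuousOn_infDist_lagrangianQ`), hence
  uniformly continuous on compact sets. Up to a small error, `|f - g(τ)|` is therefore at most
  `dist (g(τ), Q(τ, z))` for times `τ` near `t`, and by the Lipschitz condition (L6) this is at most
  `|g - Z'|(τ) + k(τ) |z - x(τ)|`. A discrete Gronwall inequality bounds the distance to `Z` by a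
  multiple of `∫ |g - Z'|` plus small errors (`exists_near_timeEpigraph`).

Only distances to `Q` are compared, so no selection of `Q` that is regular in the state is needed,
and neither is an exact trajectory that is viable in `K`. Letting the errors tend to `0` puts
`(t, Z(t))` into the closed set `K`.
-/

/-! ### Proximal normals and the epigraph of `U` -/

/-- Proximal normals lie in the polar of the Bouligand tangent cone: if the ball of radius `‖ξ‖`
around `q + ξ` has no point of `E` in its interior, then `ξ` is normal to `E` at `q`. -/
lemma mem_normalCone_of_norm_le {V : Type*} [NormedAddCommGroup V] [InnerProductSpace ℝ V]
    {E : Set V} {q ξ : V} (h : ∀ q' ∈ E, ‖ξ‖ ≤ ‖q' - (q + ξ)‖) : ξ ∈ normalCone E q := by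
  intro ζ hζ
  have key : ∀ ε : ℝ, 0 < ε → 2 * inner ℝ ζ ξ ≤ ε * (‖ζ‖ + ε) ^ 2 + 2 * ε * ‖ξ‖ := by
    intro ε hε
    have hfreq : ∃ᶠ τ : ℝ in 𝓝[>] 0,
        Metric.infEDist (q + τ • ζ) E / ENNReal.ofReal τ < ENNReal.ofReal ε := by
      refine frequently_lt_of_liminf_lt (by isBoundedDefault) ?_
      rw [show liminf _ _ = _ from hζ]
      simpa using hε
    have hev : ∀ᶠ τ : ℝ in 𝓝[>] 0, 0 < τ ∧ τ < ε :=
      Ioo_mem_nhdsGT hε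
    obtain ⟨τ, hτ, hτ0, hτε⟩ := (hfreq.and_eventually hev).exists
    rw [ENNReal.div_lt_iff (by simp [hτ0]) (by simp), ← ENNReal.ofReal_mul hε.le,
      Metric.infEDist_lt_iff] at hτ
    obtain ⟨q', hq', hd⟩ := hτ
    rw [edist_comm, edist_dist, ENNReal.ofReal_lt_ofReal_iff (by positivity), dist_eq_norm] at hd
    set e := q' - (q + τ • ζ) with he
    have h1 := h q' hq'
    have h2 : q' - (q + ξ) = (τ • ζ + e) - ξ := by rw [he]; abel
    rw [h2] at h1
    have h3 : ‖ξ‖ ^ 2 ≤ ‖(τ • ζ + e) - ξ‖ ^ 2 := by gcongr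
    rw [norm_sub_sq_real, inner_add_left, inner_smul_left] at h3
    have h4 : ‖τ • ζ + e‖ ≤ τ * (‖ζ‖ + ε) := by
      calc _ ≤ ‖τ • ζ‖ + ‖e‖ := norm_add_le _ _
        _ ≤ τ * ‖ζ‖ + ε * τ := by
          rw [norm_smul, Real.norm_of_nonneg hτ0.le]; gcongr
        _ = _ := by ring
    have h5 : ‖τ • ζ + e‖ ^ 2 ≤ (τ * (‖ζ‖ + ε)) ^ 2 := by gcongr
    have h6 : -(ε * τ * ‖ξ‖) ≤ inner ℝ e ξ := by
      have := (abs_le.1 (abs_real_inner_le_norm e ξ)).1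
      have : ‖e‖ * ‖ξ‖ ≤ ε * τ * ‖ξ‖ := by gcongr
      linarith
    simp only [conj_trivial] at h3
    have h7 : τ * (2 * inner ℝ ζ ξ) ≤ τ * (τ * (‖ζ‖ + ε) ^ 2 + 2 * ε * ‖ξ‖) := by nlinarith
    have h8 := le_of_mul_le_mul_left h7 hτ0
    have h9 : τ * (‖ζ‖ + ε) ^ 2 ≤ ε * (‖ζ‖ + ε) ^ 2 := by gcongr
    linarith
  have hlim : Tendsto (fun ε : ℝ => ε * (‖ζ‖ + ε) ^ 2 + 2 * ε * ‖ξ‖) (𝓝[>] 0) (𝓝 0) := by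
    have : Continuous (fun ε : ℝ => ε * (‖ζ‖ + ε) ^ 2 + 2 * ε * ‖ξ‖) := by fun_prop
    simpa using (this.tendsto 0).mono_left nhdsWithin_le_nhds
  have := ge_of_tendsto hlim (eventually_nhdsWithin_of_forall key)
  linarith

section Triple

variable {n : ℕ}

lemma triple_add (t s : ℝ) (x y : RN n) (u w : ℝ) :
    triple (t + s) (x + y) (u + w) = triple t x u + triple s y w := rfl

lemma triple_sub (t s : ℝ) (x y : RN n) (u w : ℝ) :
    triple (t - s) (x - y) (u - w) = triple t x u - triple s y w := rfl

lemma triple_smul (c t : ℝ) (x : RN n) (u : ℝ) :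
    triple (c * t) (c • x) (c * u) = c • triple t x u := rfl

lemma triple_inj {t s : ℝ} {x y : RN n} {u w : ℝ} :
    triple t x u = triple s y w ↔ t = s ∧ x = y ∧ u = w := by
  refine ⟨fun h => ⟨?_, ?_, ?_⟩, by rintro ⟨rfl, rfl, rfl⟩; rfl⟩
  · exact congrArg (fun p : TimeStateValue n => p.fst) h
  · exact congrArg (fun p : TimeStateValue n => p.snd.fst) h
  · exact congrArg (fun p : TimeStateValue n => p.snd.snd) h

lemma inner_triple (t s : ℝ) (x y : RN n) (u w : ℝ) :
    inner ℝ (triple t x u) (triple s y w) = t * s + inner ℝ x y + u * w := by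
  simp [triple, WithLp.prod_inner_apply]
  ring

lemma continuous_triple : Continuous fun p : ℝ × RN n × ℝ => triple p.1 p.2.1 p.2.2 := by
  unfold triple
  fun_prop

lemma norm_triple_sq (t : ℝ) (x : RN n) (u : ℝ) :
    ‖triple t x u‖ ^ 2 = t ^ 2 + ‖x‖ ^ 2 + u ^ 2 := by
  rw [← real_inner_self_eq_norm_sq, inner_triple, real_inner_self_eq_norm_sq]; ring

lemma norm_triple_le (t : ℝ) (x : RN n) (u : ℝ) : ‖triple t x u‖ ≤ |t| + ‖x‖ + |u| := by
  refine abs_le_of_sq_le_sq' ?_ (by positivity) |>.2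
  rw [norm_triple_sq, ← sq_abs t, ← sq_abs u]
  nlinarith [mul_nonneg (abs_nonneg t) (norm_nonneg x), mul_nonneg (abs_nonneg t) (abs_nonneg u),
    mul_nonneg (abs_nonneg u) (norm_nonneg x)]

lemma abs_le_norm_triple (t : ℝ) (x : RN n) (u : ℝ) : |t| ≤ ‖triple t x u‖ := by
  refine abs_le_of_sq_le_sq ?_ (norm_nonneg _)
  rw [norm_triple_sq]; nlinarith [sq_nonneg ‖x‖, sq_nonneg u]

lemma norm_le_norm_triple (t : ℝ) (x : RN n) (u : ℝ) : ‖x‖ ≤ ‖triple t x u‖ := by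
  refine abs_le_of_sq_le_sq' ?_ (norm_nonneg _) |>.2
  rw [norm_triple_sq]; nlinarith [sq_nonneg t, sq_nonneg u]

end Triple

section Epigraph

variable {n : ℕ} {T : ℝ} {L : ℝ → RN n → RN n → EReal} {U : ℝ → RN n → EReal}

lemma triple_mem_timeEpigraph {t : ℝ} {x : RN n} {u : ℝ} :
    triple t x u ∈ timeEpigraph T U ↔ t ∈ Set.Icc 0 T ∧ U t x ≤ (u : EReal) := by
  constructor
  · rintro ⟨s, hs, y, w, hU, h⟩
    obtain ⟨rfl, rfl, rfl⟩ := triple_inj.1 h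
    exact ⟨hs, hU⟩
  · rintro ⟨ht, h⟩
    exact ⟨t, ht, x, u, h, rfl⟩

lemma isClosed_timeEpigraph
    (hUlsc : LowerSemicontinuousOn (fun p : ℝ × RN n => U p.1 p.2) (Set.Icc 0 T ×ˢ Set.univ)) :
    IsClosed (timeEpigraph T U) := by
  have h := (lowerSemicontinuousOn_iff_isClosed_epigraph
    (isClosed_Icc.prod isClosed_univ)).1 hUlsc
  have hc : Continuous fun p : TimeStateValue n =>
      (((p.fst, p.snd.fst), (p.snd.snd : EReal)) : (ℝ × RN n) × EReal) := by
    refine Continuous.prodMk (by fun_prop) (continuous_coe_real_ereal.comp (by fun_prop))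
  convert! h.preimage hc using 1
  ext p
  have : p = triple p.fst p.snd.fst p.snd.snd := rfl
  rw [this, triple_mem_timeEpigraph]
  simp [triple]

/-- If `p = (s, y, r)` is a point of the epigraph nearest to `z`, then `z - p` is a proximal normal
not only at `p` but also at the point `(s, y, U(s,y))` of the graph, because the epigraph is
invariant under upward translations. Hence the normal inequality applies to it. -/
lemma inner_sub_triple_nonneg
    (hL2 : LagrangianConvexProper T L)
    (hUproper : ProperOn (fun p : ℝ × RN n => U p.1 p.2) (Set.Icc 0 T ×ˢ Set.univ))
    (hUnormal : NormalInequality T L U)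
    {z : TimeStateValue n} {s : ℝ} {y : RN n} {r : ℝ} (hs : 0 < s)
    (hp : triple s y r ∈ timeEpigraph T U)
    (hnear : ∀ q ∈ timeEpigraph T U, ‖z - triple s y r‖ ≤ ‖z - q‖)
    {f : RN n × ℝ} (hf : f ∈ lagrangianQ L s y) :
    0 ≤ inner ℝ (z - triple s y r) (triple 1 f.1 f.2) := by
  obtain ⟨hsT, hUr⟩ := triple_mem_timeEpigraph.1 hp
  have hbot : U s y ≠ ⊥ := hUproper.1 (s, y) ⟨hsT, trivial⟩
  have htop : U s y ≠ ⊤ := ne_top_of_le_ne_top (EReal.coe_ne_top r) hUr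
  lift U s y to ℝ using ⟨htop, hbot⟩ with r₀ hr₀
  have hr : r₀ ≤ r := EReal.coe_le_coe_iff.1 hUr
  have hup : ∀ a : ℝ, 0 ≤ a → ∀ q ∈ timeEpigraph T U, q + triple 0 0 a ∈ timeEpigraph T U := by
    rintro a ha q ⟨s', hs', y', r', hU', rfl⟩
    rw [← triple_add, triple_mem_timeEpigraph]
    simp only [add_zero]
    exact ⟨hs', hU'.trans (EReal.coe_le_coe_iff.2 (by linarith))⟩
  have hprox : ∀ q' ∈ timeEpigraph T U,
      ‖z - triple s y r‖ ≤ ‖q' - (triple s y r₀ + (z - triple s y r))‖ := by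
    intro q' hq'
    have h1 := hnear _ (hup (r - r₀) (by linarith) q' hq')
    rw [norm_sub_rev z (q' + _)] at h1
    have h2 : triple s y r = triple s y r₀ + triple 0 0 (r - r₀) := by
      rw [← triple_add]; simp
    have h3 : q' - (triple s y r₀ + (z - triple s y r)) = q' + triple 0 0 (r - r₀) - z := by
      rw [h2]; abel
    rwa [h3]
  have hN := mem_normalCone_of_norm_le hprox
  obtain ⟨nt, nx, nu, hξ⟩ : ∃ nt nx nu, z - triple s y r = triple nt nx nu :=
    ⟨_, _, _, rfl⟩
  rw [hξ] at hN ⊢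
  have hnu : nu ≤ 0 := by
    have htan : triple 0 0 1 ∈ tangentCone (timeEpigraph T U) (triple s y r₀) := by
      have h0 : (fun τ : ℝ => Metric.infEDist (triple s y r₀ + τ • triple 0 0 1)
          (timeEpigraph T U) / ENNReal.ofReal τ) =ᶠ[𝓝[>] 0] fun _ => 0 := by
        filter_upwards [self_mem_nhdsWithin] with τ hτ
        have hmem : triple s y r₀ + τ • triple 0 0 1 ∈ timeEpigraph T U := by
          rw [← triple_smul]
          simpa using hup τ (le_of_lt hτ) (triple s y r₀)
            (triple_mem_timeEpigraph.2 ⟨hsT, hr₀.ge⟩)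
        rw [Metric.infEDist_zero_of_mem hmem, ENNReal.zero_div]
      change liminf _ _ = 0
      rw [liminf_congr h0, liminf_const]
    have := hN _ htan
    rw [inner_triple] at this
    simpa using this
  have hfL : L s y f.1 ≤ ((-f.2 : ℝ) : EReal) := hf
  have hLbot : L s y f.1 ≠ ⊥ := (hL2 s hsT y).2.1 f.1 trivial
  have hLtop : L s y f.1 ≠ ⊤ := ne_top_of_le_ne_top (EReal.coe_ne_top _) hfL
  obtain ⟨l, hl⟩ : ∃ l : ℝ, L s y f.1 = l := ⟨_, (EReal.coe_toReal hLtop hLbot).symm⟩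
  rw [hl, EReal.coe_le_coe_iff] at hfL
  have h := hUnormal s ⟨hs, hsT.2⟩ y r₀ hr₀.symm nt nx nu hN f.1 l hl
  rw [inner_triple, real_inner_comm]
  nlinarith

/-- One Euler step backward in time. If the velocity `f` is taken from `Q` at a point of the
epigraph nearest to `z`, the squared distance to the epigraph grows only to second order in the
step size. -/
lemma infDist_sub_smul_sq_le
    (hL2 : LagrangianConvexProper T L)
    (hUproper : ProperOn (fun p : ℝ × RN n => U p.1 p.2) (Set.Icc 0 T ×ˢ Set.univ))
    (hUnormal : NormalInequality T L U)
    {z : TimeStateValue n} {s : ℝ} {y : RN n} {r : ℝ} (hs : 0 < s)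
    (hp : triple s y r ∈ timeEpigraph T U)
    (hnear : Metric.infDist z (timeEpigraph T U) = dist z (triple s y r))
    {f : RN n × ℝ} (hf : f ∈ lagrangianQ L s y) {h : ℝ} (hh : 0 ≤ h) :
    Metric.infDist (z - h • triple 1 f.1 f.2) (timeEpigraph T U) ^ 2 ≤
      Metric.infDist z (timeEpigraph T U) ^ 2 + h ^ 2 * ‖triple 1 f.1 f.2‖ ^ 2 := by
  have h0 := inner_sub_triple_nonneg hL2 hUproper hUnormal (z := z) hs hp (fun q hq => by
    rw [← dist_eq_norm, ← dist_eq_norm, ← hnear]; exact Metric.infDist_le_dist_of_mem hq) hf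
  calc _ ≤ dist (z - h • triple 1 f.1 f.2) (triple s y r) ^ 2 := by
        gcongr
        · exact Metric.infDist_nonneg
        · exact Metric.infDist_le_dist_of_mem hp
    _ = ‖(z - triple s y r) - h • triple 1 f.1 f.2‖ ^ 2 := by
        rw [dist_eq_norm]; congr 2; abel
    _ = ‖z - triple s y r‖ ^ 2 - 2 * (h * inner ℝ (z - triple s y r) (triple 1 f.1 f.2)) +
          h ^ 2 * ‖triple 1 f.1 f.2‖ ^ 2 := by
        rw [norm_sub_sq_real, inner_smul_right, norm_smul, mul_pow, Real.norm_eq_abs, sq_abs]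
    _ ≤ _ := by
        rw [hnear, dist_eq_norm]
        have := mul_nonneg hh h0
        linarith

end Epigraph

/-! ### Continuity of the velocity sets -/

section Velocity

variable {n : ℕ} {T : ℝ} {L : ℝ → RN n → RN n → EReal}

lemma isClosed_graph_lagrangianQ (hL1 : LagrangianLSC T L) :
    IsClosed {p : (ℝ × RN n) × RN n × ℝ |
      p.1.1 ∈ Set.Icc 0 T ∧ p.2 ∈ lagrangianQ L p.1.1 p.1.2} := by
  have h := (lowerSemicontinuousOn_iff_isClosed_epigraph
    (isClosed_Icc.prod isClosed_univ)).1 hL1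
  have hc : Continuous fun p : (ℝ × RN n) × RN n × ℝ =>
      (((p.1.1, p.1.2, p.2.1), ((-p.2.2 : ℝ) : EReal)) : (ℝ × RN n × RN n) × EReal) := by
    refine Continuous.prodMk (by fun_prop) (continuous_coe_real_ereal.comp (by fun_prop))
  convert! h.preimage hc using 1
  ext p
  simp [lagrangianQ, epigraph]

lemma isClosed_lagrangianQ (hL1 : LagrangianLSC T L) {t : ℝ} (ht : t ∈ Set.Icc 0 T) (x : RN n) :
    IsClosed (lagrangianQ L t x) := by
  have hc : Continuous fun q : RN n × ℝ => (((t, x), q) : (ℝ × RN n) × RN n × ℝ) := by fun_prop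
  convert! (isClosed_graph_lagrangianQ hL1).preimage hc using 1
  ext q
  simp [ht.1, ht.2]

lemma nonempty_lagrangianQ (hL2 : LagrangianConvexProper T L) {t : ℝ} (ht : t ∈ Set.Icc 0 T)
    (x : RN n) : (lagrangianQ L t x).Nonempty := by
  obtain ⟨hbot, v, -, hv⟩ := (hL2 t ht x).2
  refine ⟨(v, -(L t x v).toReal), ?_⟩
  simp [lagrangianQ, epigraph, EReal.le_coe_toReal hv]

/-- Lower semicontinuity of the set-valued map `Q`, in sequential form. -/
lemma exists_tendsto_lagrangianQ (hL2 : LagrangianConvexProper T L)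
    (hL3 : LagrangianRecovery T L) {t : ℝ} (ht : t ∈ Set.Icc 0 T) {x : RN n} {q : RN n × ℝ}
    (hq : q ∈ lagrangianQ L t x) {tk : ℕ → ℝ} {xk : ℕ → RN n} (htk : ∀ k, tk k ∈ Set.Icc 0 T)
    (ht_lim : Tendsto tk atTop (𝓝 t)) (hx_lim : Tendsto xk atTop (𝓝 x)) :
    ∃ qk : ℕ → RN n × ℝ, Tendsto qk atTop (𝓝 q) ∧
      ∀ᶠ k in atTop, qk k ∈ lagrangianQ L (tk k) (xk k) := by
  obtain ⟨vk, hv, hLk⟩ := hL3 t ht x q.1 tk xk htk ht_lim hx_lim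
  have hqL : L t x q.1 ≤ ((-q.2 : ℝ) : EReal) := hq
  have hbot : L t x q.1 ≠ ⊥ := (hL2 t ht x).2.1 q.1 trivial
  have htop : L t x q.1 ≠ ⊤ := ne_top_of_le_ne_top (EReal.coe_ne_top _) hqL
  have hreal : Tendsto (fun k => (L (tk k) (xk k) (vk k)).toReal) atTop
      (𝓝 (L t x q.1).toReal) := (EReal.tendsto_toReal htop hbot).comp hLk
  have hle : q.2 ≤ -(L t x q.1).toReal := by
    have := EReal.toReal_le_toReal hqL hbot (EReal.coe_ne_top _)
    rw [EReal.toReal_coe] at this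
    linarith
  refine ⟨fun k => (vk k, min q.2 (-(L (tk k) (xk k) (vk k)).toReal)), ?_, ?_⟩
  · have h := hv.prodMk_nhds ((tendsto_const_nhds (x := q.2)).min hreal.neg)
    rwa [min_eq_left hle] at h
  · filter_upwards [hLk.eventually_ne htop] with k hk
    change L (tk k) (xk k) (vk k) ≤ ((-min q.2 (-(L (tk k) (xk k) (vk k)).toReal) : ℝ) : EReal)
    refine (EReal.le_coe_toReal hk).trans (EReal.coe_le_coe_iff.2 ?_)
    have := min_le_right q.2 (-(L (tk k) (xk k) (vk k)).toReal)
    linarith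

/-- The distance from `g(t)` to `Q(t,x)` is continuous in `(t,x)`: `Q` is lower semicontinuous with
closed graph, and the ambient space is finite-dimensional. -/
lemma continuousOn_infDist_lagrangianQ (hL1 : LagrangianLSC T L) (hL2 : LagrangianConvexProper T L)
    (hL3 : LagrangianRecovery T L) {g : ℝ → RN n × ℝ} (hg : Continuous g) :
    ContinuousOn (fun p : ℝ × RN n => Metric.infDist (g p.1) (lagrangianQ L p.1 p.2))
      (Set.Icc 0 T ×ˢ Set.univ) := by
  rintro ⟨t, x⟩ ⟨ht, -⟩
  refine tendsto_of_subseq_tendsto fun p hp => ?_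
  rw [tendsto_nhdsWithin_iff] at hp
  obtain ⟨hp, hmem⟩ := hp
  obtain ⟨N, hN⟩ := eventually_atTop.1 hmem
  set tk : ℕ → ℝ := fun k => (p (k + N)).1
  set xk : ℕ → RN n := fun k => (p (k + N)).2
  have htk : ∀ k, tk k ∈ Set.Icc 0 T := fun k => (hN (k + N) (by omega)).1
  have hpN := hp.comp (tendsto_add_atTop_nat N)
  have ht_lim : Tendsto tk atTop (𝓝 t) := (continuous_fst.tendsto _).comp hpN
  have hx_lim : Tendsto xk atTop (𝓝 x) := (continuous_snd.tendsto _).comp hpN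
  have hg_lim : Tendsto (fun k => g (tk k)) atTop (𝓝 (g t)) := (hg.tendsto t).comp ht_lim
  obtain ⟨q, hq, hdq⟩ := (isClosed_lagrangianQ hL1 ht x).exists_infDist_eq_dist
    (nonempty_lagrangianQ hL2 ht x) (g t)
  obtain ⟨qk, hqk, hqkmem⟩ := exists_tendsto_lagrangianQ hL2 hL3 ht hq htk ht_lim hx_lim
  choose f hf hdf using fun k => (isClosed_lagrangianQ hL1 (htk k) (xk k)).exists_infDist_eq_dist
    (nonempty_lagrangianQ hL2 (htk k) (xk k)) (g (tk k))
  have hdist : Tendsto (fun k => dist (g (tk k)) (qk k)) atTop (𝓝 (dist (g t) q)) :=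
    hg_lim.dist hqk
  have hle : ∀ᶠ k in atTop, dist (g (tk k)) (f k) ≤ dist (g (tk k)) (qk k) := by
    filter_upwards [hqkmem] with k hk
    rw [← hdf k]
    exact Metric.infDist_le_dist_of_mem hk
  -- The nearest points `f k` stay bounded, so a subsequence converges.
  have hbdd : ∃ᶠ k in atTop, f k ∈ Metric.closedBall (g t) (1 + (dist (g t) q + 1)) := by
    refine Eventually.frequently ?_
    filter_upwards [hle, hdist.eventually (gt_mem_nhds (lt_add_one _)),
      hg_lim.eventually (Metric.ball_mem_nhds _ one_pos)] with k h1 h2 h3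
    rw [Metric.mem_closedBall, dist_comm]
    have := dist_triangle (g t) (g (tk k)) (f k)
    rw [dist_comm] at h3
    linarith
  obtain ⟨q', -, φ, hφ, hlim⟩ :=
    tendsto_subseq_of_frequently_bounded Metric.isBounded_closedBall hbdd
  have hq' : q' ∈ lagrangianQ L t x := by
    have hl := ((ht_lim.prodMk_nhds hx_lim).comp hφ.tendsto_atTop).prodMk_nhds hlim
    exact ((isClosed_graph_lagrangianQ hL1).mem_of_tendsto hl
      (Eventually.of_forall fun k => ⟨htk (φ k), hf (φ k)⟩)).2
  have hd' : Tendsto (fun k => dist (g (tk (φ k))) (f (φ k))) atTop (𝓝 (dist (g t) q')) :=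
    (hg_lim.comp hφ.tendsto_atTop).dist hlim
  have heq : dist (g t) q' = dist (g t) q := by
    refine le_antisymm ?_ (hdq ▸ Metric.infDist_le_dist_of_mem hq')
    exact le_of_tendsto_of_tendsto hd' (hdist.comp hφ.tendsto_atTop)
      (hφ.tendsto_atTop.eventually hle)
  refine ⟨fun k => φ k + N, ?_⟩
  change Tendsto (fun k => Metric.infDist (g (tk (φ k))) (lagrangianQ L (tk (φ k)) (xk (φ k))))
    atTop (𝓝 (Metric.infDist (g t) (lagrangianQ L t x)))
  rw [hdq, ← heq]
  exact hd'.congr fun k => (hdf (φ k)).symm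

/-- The Lipschitz condition on `L`, restated for the sets `Q(t,·)`. -/
lemma exists_mem_lagrangianQ_dist_le (hL2 : LagrangianConvexProper T L)
    {R : ℝ} {k : ℝ → ℝ} (hk0 : ∀ t ∈ Set.Icc 0 T, 0 ≤ k t)
    (hk : ∀ᵐ t ∂(volume.restrict (Set.Icc 0 T)),
      ∀ x ∈ Metric.closedBall (0 : RN n) R, ∀ y ∈ Metric.closedBall (0 : RN n) R,
        ∀ v ∈ effDom (L t x), ∃ w ∈ effDom (L t y),
          ‖w - v‖ ≤ k t * ‖y - x‖ ∧
          L t y w ≤ L t x v + ((k t * ‖y - x‖ : ℝ) : EReal)) :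
    ∀ᵐ t ∂(volume.restrict (Set.Icc 0 T)),
      ∀ x ∈ Metric.closedBall (0 : RN n) R, ∀ y ∈ Metric.closedBall (0 : RN n) R,
        ∀ q ∈ lagrangianQ L t x, ∃ q' ∈ lagrangianQ L t y, dist q q' ≤ k t * ‖y - x‖ := by
  filter_upwards [hk, ae_restrict_mem measurableSet_Icc] with t hkt ht x hx y hy q hq
  have hqL : L t x q.1 ≤ ((-q.2 : ℝ) : EReal) := hq
  obtain ⟨w, -, hw, hLw⟩ := hkt x hx y hy q.1
    ⟨ne_top_of_le_ne_top (EReal.coe_ne_top _) hqL, (hL2 t ht x).2.1 q.1 trivial⟩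
  refine ⟨(w, q.2 - k t * ‖y - x‖), ?_, ?_⟩
  · change L t y w ≤ ((-(q.2 - k t * ‖y - x‖) : ℝ) : EReal)
    refine hLw.trans ((add_le_add_left hqL _).trans ?_)
    rw [← EReal.coe_add]
    exact EReal.coe_le_coe_iff.2 (by linarith)
  · rw [Prod.dist_eq, dist_eq_norm, dist_eq_norm, norm_sub_rev]
    refine max_le hw ?_
    simp [abs_of_nonneg (hk0 t ht)]

end Velocity

/-! ### The fundamental theorem of calculus for vector-valued functions -/

section AbsolutelyContinuous

lemma LipschitzWith.comp_absolutelyContinuousOnInterval {X Y : Type*} [PseudoMetricSpace X]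
    [PseudoMetricSpace Y] {φ : X → Y} (hφ : LipschitzWith 1 φ) {f : ℝ → X} {a b : ℝ}
    (hf : AbsolutelyContinuousOnInterval f a b) :
    AbsolutelyContinuousOnInterval (φ ∘ f) a b := by
  rw [absolutelyContinuousOnInterval_iff] at hf ⊢
  intro ε hε
  obtain ⟨δ, hδ, h⟩ := hf ε hε
  refine ⟨δ, hδ, fun E hE hsum => lt_of_le_of_lt (Finset.sum_le_sum fun i _ => ?_) (h E hE hsum)⟩
  simpa using hφ.dist_le_mul (f (E.2 i).1) (f (E.2 i).2)

variable {n : ℕ} {x : ℝ → RN n} {a b : ℝ}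

/-- A coordinatewise reduction to the real-valued fundamental theorem of calculus. -/
lemma AbsolutelyContinuousOnInterval.integrableOn_deriv_and_integral_eq
    (hx : AbsolutelyContinuousOnInterval x a b) (hab : a ≤ b)
    (hd : ∀ᵐ t ∂(volume.restrict (Set.Icc a b)), DifferentiableAt ℝ x t) :
    IntegrableOn (deriv x) (Set.Ioc a b) ∧ ∫ t in Set.Ioc a b, deriv x t = x b - x a := by
  have hcoord : ∀ i, AbsolutelyContinuousOnInterval (fun t => x t i) a b := fun i =>
    LipschitzWith.comp_absolutelyContinuousOnInterval (φ := fun y : RN n => y i)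
      (LipschitzWith.of_dist_le_mul fun y z => by
        simpa [dist_eq_norm] using PiLp.norm_apply_le (y - z) i) hx
  have hd' : ∀ᵐ t ∂(volume.restrict (Set.Ioc a b)), DifferentiableAt ℝ x t :=
    ae_restrict_of_ae_restrict_of_subset Set.Ioc_subset_Icc_self hd
  have hderiv : ∀ i, (fun t => deriv x t i) =ᵐ[volume.restrict (Set.Ioc a b)]
      deriv (fun t => x t i) := by
    intro i
    filter_upwards [hd'] with t ht
    exact (((EuclideanSpace.proj (𝕜 := ℝ) i).hasFDerivAt.comp_hasDerivAt t
      ht.hasDerivAt).deriv).symm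
  have hint : ∀ i, Integrable (fun t => deriv x t i) (volume.restrict (Set.Ioc a b)) := fun i =>
    ((intervalIntegrable_iff_integrableOn_Ioc_of_le hab).1
      (hcoord i).intervalIntegrable_deriv).congr (hderiv i).symm
  refine ⟨Integrable.of_eval_piLp hint, ?_⟩
  ext i
  rw [eval_integral_piLp hint, integral_congr_ae (hderiv i),
    ← intervalIntegral.integral_of_le hab, (hcoord i).integral_deriv_eq_sub]
  rfl

end AbsolutelyContinuous

/-! ### The discrete Euler scheme -/

section Euler

variable {n : ℕ} {T : ℝ} {L : ℝ → RN n → RN n → EReal} {U : ℝ → RN n → EReal}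

/-- The velocity of an Euler step at `(t, z)`: the point of `Q` nearest to `g`, evaluated at a
point of the epigraph nearest to `(t, z)`. Uniform continuity of the distance from `g` to `Q` and
of `g`, with modulus `ρ` for the tolerance `δ`, allows the velocity to be compared with `g` at all
nearby times. -/
lemma exists_euler_velocity
    (hL1 : LagrangianLSC T L) (hL2 : LagrangianConvexProper T L)
    (hUproper : ProperOn (fun p : ℝ × RN n => U p.1 p.2) (Set.Icc 0 T ×ˢ Set.univ))
    (hUlsc : LowerSemicontinuousOn (fun p : ℝ × RN n => U p.1 p.2) (Set.Icc 0 T ×ˢ Set.univ))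
    (hUnormal : NormalInequality T L U) {g : ℝ → RN n × ℝ} {R δ ρ M : ℝ} (hρ1 : ρ ≤ 1)
    (hmod : ∀ s ∈ Set.Icc 0 T, ∀ y ∈ Metric.closedBall (0 : RN n) R,
      ∀ τ ∈ Set.Icc 0 T, ∀ y' ∈ Metric.closedBall (0 : RN n) R, |s - τ| ≤ ρ → dist y y' ≤ ρ →
        |Metric.infDist (g s) (lagrangianQ L s y) - Metric.infDist (g τ) (lagrangianQ L τ y')| ≤ δ
          ∧ dist (g s) (g τ) ≤ δ)
    (hM : ∀ s ∈ Set.Icc 0 T, ∀ y ∈ Metric.closedBall (0 : RN n) R,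
      Metric.infDist (g s) (lagrangianQ L s y) + ‖g s‖ ≤ M)
    {t h : ℝ} (htT : t ≤ T) (hh : 0 ≤ h) (hhρ : h ≤ ρ / 2) (htρ : ρ / 2 < t)
    {z : RN n × ℝ} (hzR : ‖z.1‖ ≤ R - 1)
    (hzK : Metric.infDist (triple t z.1 z.2) (timeEpigraph T U) ≤ ρ / 2) :
    ∃ f : RN n × ℝ,
      Metric.infDist (triple (t - h) (z - h • f).1 (z - h • f).2) (timeEpigraph T U) ^ 2 ≤
        Metric.infDist (triple t z.1 z.2) (timeEpigraph T U) ^ 2 + h ^ 2 * (1 + 2 * M) ^ 2 ∧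
      ∀ τ ∈ Set.Icc (t - h) t,
        dist f (g τ) ≤ Metric.infDist (g τ) (lagrangianQ L τ z.1) + 2 * δ := by
  have hne : (timeEpigraph T U).Nonempty := by
    obtain ⟨-, ⟨s, y⟩, ⟨hs, -⟩, htop⟩ := hUproper
    exact ⟨triple s y (U s y).toReal,
      triple_mem_timeEpigraph.2 ⟨hs, EReal.le_coe_toReal htop⟩⟩
  obtain ⟨p, hp, hdp⟩ := (isClosed_timeEpigraph hUlsc).exists_infDist_eq_dist hne
    (triple t z.1 z.2)
  obtain ⟨s, hs, y, r, hUr, rfl⟩ := id hp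
  have hd : ‖triple (t - s) (z.1 - y) (z.2 - r)‖ ≤ ρ / 2 := by
    rw [triple_sub, ← dist_eq_norm, ← hdp]; exact hzK
  have hts : |t - s| ≤ ρ / 2 := (abs_le_norm_triple _ _ _).trans hd
  have hyz : ‖z.1 - y‖ ≤ ρ / 2 := (norm_le_norm_triple _ _ _).trans hd
  have hρ0 : 0 ≤ ρ := by linarith
  have hs0 : 0 < s := by linarith [(abs_le.1 hts).2]
  have hyR : y ∈ Metric.closedBall (0 : RN n) R := by
    rw [mem_closedBall_zero_iff]
    have := norm_le_norm_add_norm_sub z.1 y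
    linarith
  have hzR' : z.1 ∈ Metric.closedBall (0 : RN n) R := by
    rw [mem_closedBall_zero_iff]; linarith
  obtain ⟨f, hf, hdf⟩ := (isClosed_lagrangianQ hL1 hs y).exists_infDist_eq_dist
    (nonempty_lagrangianQ hL2 hs y) (g s)
  have hfM : ‖f‖ ≤ M := by
    have h1 := hM s hs y hyR
    rw [hdf, dist_eq_norm] at h1
    have h2 := norm_le_norm_add_norm_sub (g s) f
    linarith
  have hfM' : ‖triple 1 f.1 f.2‖ ≤ 1 + 2 * M := by
    have h1 := norm_triple_le 1 f.1 f.2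
    have h2 := norm_fst_le f
    have h3 := norm_snd_le f
    rw [Real.norm_eq_abs] at h3
    rw [abs_one] at h1
    linarith
  refine ⟨f, ?_, fun τ hτ => ?_⟩
  · have hstep := infDist_sub_smul_sq_le hL2 hUproper hUnormal hs0 hp hdp hf hh
    have heq : triple (t - h) (z - h • f).1 (z - h • f).2 =
        triple t z.1 z.2 - h • triple 1 f.1 f.2 := by
      rw [← triple_smul, ← triple_sub, mul_one]; rfl
    rw [heq]
    refine hstep.trans ?_
    gcongr
  · have hτT : τ ∈ Set.Icc 0 T := ⟨by linarith [hτ.1], hτ.2.trans htT⟩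
    have hsτ : |s - τ| ≤ ρ := by
      rw [abs_le] at hts ⊢
      constructor <;> linarith [hτ.1, hτ.2]
    obtain ⟨h1, h2⟩ := hmod s hs y hyR τ hτT z.1 hzR' hsτ (by
      rw [dist_comm, dist_eq_norm]; linarith)
    have h3 := dist_triangle f (g s) (g τ)
    rw [dist_comm f (g s), ← hdf] at h3
    linarith [(abs_le.1 h1).2]

/-- One step of the discrete Gronwall inequality. -/
lemma le_exp_mul_of_le_add {A A' B B' e e' : ℝ} (hA : 0 ≤ A) (hAA : A ≤ A') (hBB : B ≤ B')
    (he : e ≤ Real.exp A * B) (he0 : 0 ≤ e)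
    (hstep : e' ≤ e + ((A' - A) * e + (B' - B))) : e' ≤ Real.exp A' * B' := by
  have h1 : e + (A' - A) * e ≤ Real.exp (A' - A) * (Real.exp A * B) := by
    have := Real.add_one_le_exp (A' - A)
    calc e + (A' - A) * e = (A' - A + 1) * e := by ring
      _ ≤ Real.exp (A' - A) * e := by gcongr
      _ ≤ _ := by gcongr
  rw [← mul_assoc, ← Real.exp_add, sub_add_cancel] at h1
  have h2 : B' - B ≤ Real.exp A' * (B' - B) :=
    le_mul_of_one_le_left (by linarith) (Real.one_le_exp (hA.trans hAA))
  linarith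

end Euler

/-! ### Convergence of the scheme -/

section Approximation

/-- How far an Euler step from `z` at time `t` back to time `s` drifts from the trajectory `Z`. -/
lemma norm_sub_smul_sub_le {V : Type*} [NormedAddCommGroup V] [NormedSpace ℝ V] [CompleteSpace V]
    {Z Z' : ℝ → V} {s t : ℝ} (hst : s ≤ t) (hint : IntervalIntegrable Z' volume s t)
    (hZ : ∫ τ in s..t, Z' τ = Z t - Z s) {φ : ℝ → ℝ} (hφ : IntervalIntegrable φ volume s t)
    {f z : V} (hf : ∀ᵐ τ ∂(volume.restrict (Set.Ioc s t)), ‖f - Z' τ‖ ≤ φ τ) :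
    ‖(z - (t - s) • f) - Z s‖ ≤ ‖z - Z t‖ + ∫ τ in s..t, φ τ := by
  have h1 : (z - (t - s) • f) - Z s = (z - Z t) - ∫ τ in s..t, (f - Z' τ) := by
    rw [intervalIntegral.integral_sub intervalIntegrable_const hint, hZ,
      intervalIntegral.integral_const]
    abel
  rw [h1]
  refine (norm_sub_le _ _).trans (add_le_add le_rfl ?_)
  exact intervalIntegral.norm_integral_le_of_norm_le hst
    ((ae_restrict_iff' measurableSet_Ioc).1 hf) hφ

variable {n : ℕ} {T : ℝ} {L : ℝ → RN n → RN n → EReal} {U : ℝ → RN n → EReal}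

lemma infDist_lagrangianQ_le {R : ℝ} {x y : RN n} {t k : ℝ} {g q : RN n × ℝ}
    (hk : ∀ x ∈ Metric.closedBall (0 : RN n) R, ∀ y ∈ Metric.closedBall (0 : RN n) R,
      ∀ q ∈ lagrangianQ L t x, ∃ q' ∈ lagrangianQ L t y, dist q q' ≤ k * ‖y - x‖)
    (hx : x ∈ Metric.closedBall (0 : RN n) R) (hy : y ∈ Metric.closedBall (0 : RN n) R)
    (hq : q ∈ lagrangianQ L t x) :
    Metric.infDist g (lagrangianQ L t y) ≤ ‖q - g‖ + k * ‖y - x‖ := by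
  obtain ⟨q', hq', hd⟩ := hk x hx y hy q hq
  have h1 := Metric.infDist_le_dist_of_mem hq' (x := g)
  have h2 := dist_triangle g q q'
  rw [dist_comm g q, dist_eq_norm q g] at h2
  linarith

/-- On the compact set `[0,T] × B_R` the distance from `g` to `Q` and the function `g` itself are
uniformly continuous and bounded. -/
lemma exists_modulus_and_bound
    (hL1 : LagrangianLSC T L) (hL2 : LagrangianConvexProper T L) (hL3 : LagrangianRecovery T L)
    {g : ℝ → RN n × ℝ} (hg : Continuous g) (R : ℝ) {δ : ℝ} (hδ : 0 < δ) :
    ∃ ρ : ℝ, 0 < ρ ∧ ∃ M : ℝ,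
      (∀ s ∈ Set.Icc 0 T, ∀ y ∈ Metric.closedBall (0 : RN n) R,
        ∀ τ ∈ Set.Icc 0 T, ∀ y' ∈ Metric.closedBall (0 : RN n) R, |s - τ| ≤ ρ → dist y y' ≤ ρ →
          |Metric.infDist (g s) (lagrangianQ L s y) -
            Metric.infDist (g τ) (lagrangianQ L τ y')| ≤ δ ∧ dist (g s) (g τ) ≤ δ) ∧
      ∀ s ∈ Set.Icc 0 T, ∀ y ∈ Metric.closedBall (0 : RN n) R,
        Metric.infDist (g s) (lagrangianQ L s y) + ‖g s‖ ≤ M := by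
  set D : ℝ × RN n → ℝ := fun p => Metric.infDist (g p.1) (lagrangianQ L p.1 p.2) with hD
  have hDc : ContinuousOn D (Set.Icc 0 T ×ˢ Metric.closedBall 0 R) :=
    (continuousOn_infDist_lagrangianQ hL1 hL2 hL3 hg).mono
      (Set.prod_mono le_rfl (Set.subset_univ _))
  have hcomp : IsCompact (Set.Icc (0 : ℝ) T ×ˢ Metric.closedBall (0 : RN n) R) :=
    isCompact_Icc.prod (isCompact_closedBall _ _)
  obtain ⟨ρ₁, hρ₁, hmod₁⟩ := Metric.uniformContinuousOn_iff_le.1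
    (hcomp.uniformContinuousOn_of_continuous hDc) δ hδ
  obtain ⟨ρ₂, hρ₂, hmod₂⟩ := Metric.uniformContinuousOn_iff_le.1
    (isCompact_Icc.uniformContinuousOn_of_continuous (hg.continuousOn (s := Set.Icc 0 T))) δ hδ
  obtain ⟨m, hm⟩ := hcomp.exists_bound_of_continuousOn hDc
  obtain ⟨m', hm'⟩ := isCompact_Icc.exists_bound_of_continuousOn
    (hg.continuousOn (s := Set.Icc 0 T))
  refine ⟨min ρ₁ ρ₂, by positivity, m + m', fun s hs y hy τ hτ y' hy' h1 h2 => ⟨?_, ?_⟩,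
    fun s hs y hy => ?_⟩
  · have := hmod₁ (s, y) ⟨hs, hy⟩ (τ, y') ⟨hτ, hy'⟩ (by
      rw [Prod.dist_eq, Real.dist_eq]
      exact (max_le h1 h2).trans (min_le_left _ _))
    rwa [Real.dist_eq] at this
  · exact hmod₂ s hs τ hτ (by rw [Real.dist_eq]; exact h1.trans (min_le_right _ _))
  · exact add_le_add ((le_abs_self _).trans (hm (s, y) ⟨hs, hy⟩)) (hm' s hs)

set_option maxHeartbeats 1000000 in
/-- The Euler scheme started at `Z(T)` in the epigraph reaches time `t₁` arbitrarily close both to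
the epigraph and to the trajectory `Z`. -/
lemma exists_near_timeEpigraph
    (hL1 : LagrangianLSC T L) (hL2 : LagrangianConvexProper T L) (hL3 : LagrangianRecovery T L)
    (hL6 : LagrangianLipschitz T L)
    (hUproper : ProperOn (fun p : ℝ × RN n => U p.1 p.2) (Set.Icc 0 T ×ˢ Set.univ))
    (hUlsc : LowerSemicontinuousOn (fun p : ℝ × RN n => U p.1 p.2) (Set.Icc 0 T ×ˢ Set.univ))
    (hUnormal : NormalInequality T L U) {t₁ : ℝ} (ht₁ : 0 < t₁) (ht₁T : t₁ ≤ T)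
    {Z Z' : ℝ → RN n × ℝ} (hZc : ContinuousOn Z (Set.Icc t₁ T))
    (hZint : IntegrableOn Z' (Set.Ioc t₁ T))
    (hZ : ∀ s ∈ Set.Icc t₁ T, ∀ t ∈ Set.Icc t₁ T, s ≤ t → ∫ τ in s..t, Z' τ = Z t - Z s)
    (hZQ : ∀ᵐ τ ∂(volume.restrict (Set.Ioc t₁ T)), Z' τ ∈ lagrangianQ L τ (Z τ).1)
    (hend : triple T (Z T).1 (Z T).2 ∈ timeEpigraph T U) {ε : ℝ} (hε : 0 < ε) (hε1 : ε ≤ 1) :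
    ∃ z : RN n × ℝ, Metric.infDist (triple t₁ z.1 z.2) (timeEpigraph T U) ≤ ε ∧
      ‖z - Z t₁‖ ≤ ε := by
  obtain ⟨r, hr⟩ := (isCompact_Icc.image_of_continuousOn hZc).isBounded.exists_norm_le
  replace hr : ∀ τ ∈ Set.Icc t₁ T, ‖Z τ‖ ≤ r := fun τ hτ => hr _ ⟨τ, hτ, rfl⟩
  have hr0 : 0 ≤ r := (norm_nonneg _).trans (hr T ⟨ht₁T, le_rfl⟩)
  set R := r + 2 with hR
  obtain ⟨k, hkint, hk0, hk⟩ := hL6 R (by positivity)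
  replace hk := exists_mem_lagrangianQ_dist_le hL2 hk0 hk
  have hsub : Set.Icc t₁ T ⊆ Set.Icc 0 T := Set.Icc_subset_Icc_left ht₁.le
  replace hk := ae_restrict_of_ae_restrict_of_subset (Set.Ioc_subset_Icc_self.trans hsub) hk
  replace hkint : IntegrableOn k (Set.Ioc t₁ T) :=
    hkint.mono_set (Set.Ioc_subset_Icc_self.trans hsub)
  have hII : ∀ {W : Type} [NormedAddCommGroup W] {φ : ℝ → W}, IntegrableOn φ (Set.Ioc t₁ T) →
      ∀ s ∈ Set.Icc t₁ T, ∀ t ∈ Set.Icc t₁ T, IntervalIntegrable φ volume s t :=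
    fun hφ s hs t ht => ((intervalIntegrable_iff_integrableOn_Ioc_of_le ht₁T).2 hφ).mono_set
      (by rw [Set.uIcc_of_le ht₁T]; exact Set.uIcc_subset_Icc hs ht)
  have hmem₁ : t₁ ∈ Set.Icc t₁ T := ⟨le_rfl, ht₁T⟩
  have hmemT : T ∈ Set.Icc t₁ T := ⟨ht₁T, le_rfl⟩
  have hmono : ∀ {φ : ℝ → ℝ}, IntegrableOn φ (Set.Ioc t₁ T) → (∀ τ ∈ Set.Icc t₁ T, 0 ≤ φ τ) →
      ∀ s ∈ Set.Icc t₁ T, ∀ t ∈ Set.Icc t₁ T, s ≤ t →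
        0 ≤ ∫ τ in t..T, φ τ ∧ (∫ τ in t..T, φ τ) ≤ ∫ τ in s..T, φ τ := by
    intro φ hφ hφ0 s hs t ht hst
    refine ⟨intervalIntegral.integral_nonneg ht.2 fun τ hτ => hφ0 τ ⟨ht.1.trans hτ.1, hτ.2⟩, ?_⟩
    rw [← intervalIntegral.integral_add_adjacent_intervals (hII hφ s hs t ht)
      (hII hφ t ht T hmemT)]
    have : 0 ≤ ∫ τ in s..t, φ τ := intervalIntegral.integral_nonneg hst fun τ hτ =>
      hφ0 τ ⟨hs.1.trans hτ.1, hτ.2.trans ht.2⟩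
    linarith
  have hk0' : ∀ τ ∈ Set.Icc t₁ T, 0 ≤ k τ := fun τ hτ => hk0 τ (hsub hτ)
  set κ := ∫ τ in t₁..T, k τ with hκ
  have hκ0 : 0 ≤ κ := (hmono hkint hk0' t₁ hmem₁ t₁ hmem₁ le_rfl).1
  -- The tolerance `δ` is shared by the `L¹` approximation of `Z'` and by all moduli of continuity;
  -- dividing by `c` makes the final Gronwall bound at most `ε`.
  set c := Real.exp κ * (2 * (T - t₁) + 2 + κ) with hc
  have hc0 : 0 < c := by have : 0 ≤ T - t₁ := by linarith
                         positivity
  set δ := ε / c with hδ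
  have hδ0 : 0 < δ := by positivity
  obtain ⟨g, -, hgδ, hgc, hgint⟩ := Integrable.exists_hasCompactSupport_integral_sub_le hZint hδ0
  set b : ℝ → ℝ := fun τ => 2 * δ + 2 * ‖Z' τ - g τ‖ + δ * k τ with hb
  have hZg : IntegrableOn (fun τ => ‖Z' τ - g τ‖) (Set.Ioc t₁ T) := (hZint.sub hgint).norm
  have hbint : IntegrableOn b (Set.Ioc t₁ T) :=
    (((integrable_const (2 * δ)).add (hZg.const_mul 2)).add (hkint.const_mul δ))
  have hb0 : ∀ τ ∈ Set.Icc t₁ T, 0 ≤ b τ := fun τ hτ => by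
    have := hk0' τ hτ
    positivity
  have hbε : Real.exp κ * ∫ τ in t₁..T, b τ ≤ ε := by
    have h1 : ∫ τ in t₁..T, b τ ≤ δ * (2 * (T - t₁) + 2 + κ) := by
      rw [hb, intervalIntegral.integral_add
          ((intervalIntegrable_const).add ((hII hZg t₁ hmem₁ T hmemT).const_mul 2))
          ((hII hkint t₁ hmem₁ T hmemT).const_mul δ),
        intervalIntegral.integral_add intervalIntegrable_const
          ((hII hZg t₁ hmem₁ T hmemT).const_mul 2), intervalIntegral.integral_const,
        intervalIntegral.integral_const_mul, intervalIntegral.integral_const_mul,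
        intervalIntegral.integral_of_le ht₁T (f := fun τ => ‖Z' τ - g τ‖), smul_eq_mul, ← hκ]
      linarith
    calc _ ≤ Real.exp κ * (δ * (2 * (T - t₁) + 2 + κ)) := by gcongr
      _ = ε / c * c := by rw [hc]; ring
      _ = ε := div_mul_cancel₀ _ hc0.ne'
  obtain ⟨ρ₁, hρ₁, M, hmod₁, hM⟩ := exists_modulus_and_bound hL1 hL2 hL3 hgc R hδ0
  obtain ⟨ρ₂, hρ₂, hmod₂⟩ := Metric.uniformContinuousOn_iff_le.1
    (isCompact_Icc.uniformContinuousOn_of_continuous hZc) δ hδ0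
  set ρ := min (min ρ₁ ρ₂) (min 1 t₁) with hρ
  have hρ0 : 0 < ρ := by positivity
  have hρρ₁ : ρ ≤ ρ₁ := (min_le_left _ _).trans (min_le_left _ _)
  have hρρ₂ : ρ ≤ ρ₂ := (min_le_left _ _).trans (min_le_right _ _)
  have hρ1 : ρ ≤ 1 := (min_le_right _ _).trans (min_le_left _ _)
  have hρt : ρ ≤ t₁ := (min_le_right _ _).trans (min_le_right _ _)
  set η := min (ρ / 2) ε with hη
  have hη0 : 0 < η := by positivity
  obtain ⟨N, hN0, hNρ, hNη⟩ : ∃ N : ℕ, 0 < N ∧ (T - t₁) / N ≤ ρ / 2 ∧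
      (T - t₁) * ((T - t₁) / N) * (1 + 2 * M) ^ 2 ≤ η ^ 2 := by
    have h0 : Tendsto (fun N : ℕ => (T - t₁) / (N : ℝ)) atTop (𝓝 0) :=
      tendsto_const_div_atTop_nhds_zero_nat _
    have h1 : Tendsto (fun N : ℕ => (T - t₁) * ((T - t₁) / (N : ℝ)) * (1 + 2 * M) ^ 2)
        atTop (𝓝 0) := by simpa using (h0.const_mul (T - t₁)).mul_const ((1 + 2 * M) ^ 2)
    exact ((eventually_gt_atTop 0).and ((h0.eventually (ge_mem_nhds (by positivity))).and
      (h1.eventually (ge_mem_nhds (by positivity))))).exists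
  set h := (T - t₁) / N with hh
  have hN0' : (0 : ℝ) < N := by exact_mod_cast hN0
  have hNh : N * h = T - t₁ := by rw [hh]; field_simp
  have hh0 : 0 ≤ h := div_nonneg (by linarith) hN0'.le
  have hti : ∀ i : ℕ, i ≤ N → T - i * h ∈ Set.Icc t₁ T := fun i hi => by
    have : (i : ℝ) * h ≤ N * h := by gcongr
    have : 0 ≤ (i : ℝ) * h := by positivity
    constructor <;> linarith
  have hdη : ∀ i : ℕ, i ≤ N → ∀ d : ℝ, d ^ 2 ≤ i * (h ^ 2 * (1 + 2 * M) ^ 2) → d ≤ η := by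
    intro i hi d hd
    refine abs_le_of_sq_le_sq' (hd.trans ?_) hη0.le |>.2
    calc (i : ℝ) * (h ^ 2 * (1 + 2 * M) ^ 2) ≤ N * (h ^ 2 * (1 + 2 * M) ^ 2) := by gcongr
      _ = (N * h) * h * (1 + 2 * M) ^ 2 := by ring
      _ ≤ η ^ 2 := by rw [hNh]; exact hNη
  have hεi : ∀ s ∈ Set.Icc t₁ T, Real.exp (∫ τ in s..T, k τ) * ∫ τ in s..T, b τ ≤ ε := by
    intro s hs
    refine le_trans ?_ hbε
    have h1 := hmono hkint hk0' t₁ hmem₁ s hs hs.1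
    have h2 := hmono hbint hb0 t₁ hmem₁ s hs hs.1
    exact mul_le_mul (Real.exp_le_exp.2 h1.2) h2.2 h2.1 (Real.exp_pos _).le
  have main : ∀ i : ℕ, i ≤ N → ∃ z : RN n × ℝ,
      Metric.infDist (triple (T - i * h) z.1 z.2) (timeEpigraph T U) ^ 2 ≤
        i * (h ^ 2 * (1 + 2 * M) ^ 2) ∧
      ‖z - Z (T - i * h)‖ ≤
        Real.exp (∫ τ in (T - i * h)..T, k τ) * ∫ τ in (T - i * h)..T, b τ := by
    intro i
    induction i with
    | zero => exact fun _ => ⟨Z T, by simp [Metric.infDist_zero_of_mem hend], by simp⟩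
    | succ i ih =>
      intro hi
      obtain ⟨z, hzK, hzZ⟩ := ih (by omega)
      have ht := hti i (by omega)
      have ht' := hti (i + 1) hi
      have hsucc : T - ((i + 1 : ℕ) : ℝ) * h = T - i * h - h := by push_cast; ring
      rw [hsucc] at ht' ⊢
      set t := T - i * h with ht_def
      have hze : ‖z - Z t‖ ≤ 1 := (hzZ.trans (hεi t ht)).trans hε1
      have hzR : ‖z.1‖ ≤ R - 1 := by
        have h1 := norm_fst_le z
        have h2 := norm_le_norm_add_norm_sub (Z t) z
        rw [norm_sub_rev] at hze
        have h3 := hr t ht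
        linarith
      obtain ⟨f, hfK, hfg⟩ := exists_euler_velocity hL1 hL2 hUproper hUlsc hUnormal hρ1
        (fun s hs y hy τ hτ y' hy' h1 h2 =>
          hmod₁ s hs y hy τ hτ y' hy' (h1.trans hρρ₁) (h2.trans hρρ₁)) hM
        ht.2 hh0 hNρ (by linarith [ht.1]) hzR
        ((hdη i (by omega) _ hzK).trans (min_le_left _ _))
      refine ⟨z - h • f, by push_cast; linarith, ?_⟩
      have hsub' : Set.Ioc (t - h) t ⊆ Set.Ioc t₁ T := Set.Ioc_subset_Ioc ht'.1 ht.2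
      have hvel : ∀ᵐ τ ∂(volume.restrict (Set.Ioc (t - h) t)),
          ‖f - Z' τ‖ ≤ k τ * ‖z - Z t‖ + b τ := by
        filter_upwards [ae_restrict_of_ae_restrict_of_subset hsub' hk,
          ae_restrict_of_ae_restrict_of_subset hsub' hZQ,
          ae_restrict_mem measurableSet_Ioc] with τ hkτ hQτ hτ
        have hτT : τ ∈ Set.Icc t₁ T := Set.Ioc_subset_Icc_self (hsub' hτ)
        have hx : (Z τ).1 ∈ Metric.closedBall (0 : RN n) R := by
          rw [mem_closedBall_zero_iff]
          linarith [norm_fst_le (Z τ), hr τ hτT]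
        have hz : z.1 ∈ Metric.closedBall (0 : RN n) R := by
          rw [mem_closedBall_zero_iff]; linarith
        have h1 := infDist_lagrangianQ_le (g := g τ) hkτ hx hz hQτ
        have h2 := hfg τ (Set.Ioc_subset_Icc_self hτ)
        have h3 : ‖z.1 - (Z τ).1‖ ≤ ‖z - Z t‖ + δ := by
          have h4 : dist (Z t) (Z τ) ≤ δ := hmod₂ t ht τ hτT (by
            rw [Real.dist_eq, abs_of_nonneg (by linarith [hτ.2])]
            linarith [hτ.1])
          rw [dist_eq_norm] at h4
          have h5 := norm_fst_le (z - Z τ)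
          have h6 := norm_sub_le_norm_sub_add_norm_sub z (Z t) (Z τ)
          exact h5.trans (h6.trans (by linarith))
        have h7 := mul_le_mul_of_nonneg_left h3 (hk0' τ hτT)
        have h8 := norm_sub_le_norm_sub_add_norm_sub f (g τ) (Z' τ)
        rw [← dist_eq_norm f (g τ), norm_sub_rev (g τ)] at h8
        simp only [hb]
        linarith
      have hkI := hII hkint (t - h) ht' t ht
      have hbI := hII hbint (t - h) ht' t ht
      have hstep := norm_sub_smul_sub_le (z := z) (by linarith)
        (hII hZint (t - h) ht' t ht) (hZ (t - h) ht' t ht (by linarith))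
        ((hkI.mul_const ‖z - Z t‖).add hbI) hvel
      rw [intervalIntegral.integral_add (hkI.mul_const _) hbI,
        intervalIntegral.integral_mul_const, sub_sub_cancel] at hstep
      have hkA := hmono hkint hk0' (t - h) ht' t ht (by linarith)
      have hbA := hmono hbint hb0 (t - h) ht' t ht (by linarith)
      refine le_exp_mul_of_le_add hkA.1 hkA.2 hbA.2 hzZ (norm_nonneg _) ?_
      rwa [← intervalIntegral.integral_add_adjacent_intervals hkI (hII hkint t ht T hmemT),
        ← intervalIntegral.integral_add_adjacent_intervals hbI (hII hbint t ht T hmemT),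
        add_sub_cancel_right, add_sub_cancel_right]
  obtain ⟨z, hzK, hzZ⟩ := main N le_rfl
  have hNt : T - N * h = t₁ := by rw [hNh]; ring
  rw [hNt] at hzK hzZ
  have hzK' : Metric.infDist (triple t₁ z.1 z.2) (timeEpigraph T U) ≤ η :=
    hdη N le_rfl _ (by rwa [← hNt] at hzK ⊢)
  exact ⟨z, hzK'.trans (min_le_right _ _), hzZ.trans hbε⟩

end Approximation

/-! ### Invariance -/

/-- Proved for `t > t₀` by letting the accuracy of the Euler scheme tend to `0`; the normal
inequality says nothing at time `0`, so `t = t₀`, which may be `0`, is reached by closedness of the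
epigraph. -/
theorem theorem4p1 (n : ℕ) (T : ℝ) (hT : 0 < T)
    (L : ℝ → RN n → RN n → EReal)
    (hL1 : LagrangianLSC T L)
    (hL2 : LagrangianConvexProper T L)
    (hL3 : LagrangianRecovery T L)
    (hL4 : LagrangianLocallyBoundedDom T L)
    (hL5 : LagrangianLinearGrowthDom T L)
    (hL6 : LagrangianLipschitz T L)
    (U : ℝ → RN n → EReal)
    (hUproper : ProperOn (fun p : ℝ × RN n => U p.1 p.2) (Set.Icc 0 T ×ˢ Set.univ))
    (hUlsc : LowerSemicontinuousOn (fun p : ℝ × RN n => U p.1 p.2) (Set.Icc 0 T ×ˢ Set.univ))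
    (hUnormal : NormalInequality T L U)
    (t₀ : ℝ) (ht₀ : t₀ ∈ Set.Ico 0 T)
    (x : ℝ → RN n) (u : ℝ → ℝ)
    (hx : AbsolutelyContinuousOnInterval x t₀ T)
    (hu : AbsolutelyContinuousOnInterval u t₀ T)
    (hQ : ∀ᵐ t ∂(volume.restrict (Set.Icc t₀ T)),
      ∃ (x' : RN n) (u' : ℝ), HasDerivAt x x' t ∧ HasDerivAt u u' t ∧
        (x', u') ∈ lagrangianQ L t (x t))
    (hend : U T (x T) ≤ (u T : EReal)) :
    ∀ t ∈ Set.Icc t₀ T, U t (x t) ≤ (u t : EReal) := by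
  set Z : ℝ → RN n × ℝ := fun t => (x t, u t) with hZdef
  set Z' : ℝ → RN n × ℝ := fun t => (deriv x t, deriv u t)
  have hZc : ContinuousOn Z (Set.Icc t₀ T) := by
    have h1 := hx.continuousOn
    have h2 := hu.continuousOn
    rw [Set.uIcc_of_le ht₀.2.le] at h1 h2
    exact h1.prodMk h2
  have hdiff : ∀ᵐ t ∂(volume.restrict (Set.Icc t₀ T)), DifferentiableAt ℝ x t := by
    filter_upwards [hQ] with t ⟨x', u', h, _⟩ using h.differentiableAt
  have hZQ : ∀ᵐ t ∂(volume.restrict (Set.Icc t₀ T)), Z' t ∈ lagrangianQ L t (Z t).1 := by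
    filter_upwards [hQ] with t ⟨x', u', h1, h2, h3⟩
    change (deriv x t, deriv u t) ∈ _
    rwa [h1.deriv, h2.deriv]
  have hZint : ∀ s ∈ Set.Icc t₀ T, ∀ t ∈ Set.Icc t₀ T, s ≤ t →
      IntegrableOn Z' (Set.Ioc s t) ∧ ∫ τ in s..t, Z' τ = Z t - Z s := by
    intro s hs t ht hst
    have hsub : Set.uIcc s t ⊆ Set.uIcc t₀ T := by
      rw [Set.uIcc_of_le ht₀.2.le]; exact Set.uIcc_subset_Icc hs ht
    obtain ⟨hxi, hxe⟩ := (hx.mono hsub).integrableOn_deriv_and_integral_eq hst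
      (ae_restrict_of_ae_restrict_of_subset (Set.Icc_subset_Icc hs.1 ht.2) hdiff)
    have hui := (intervalIntegrable_iff_integrableOn_Ioc_of_le hst).1
      (hu.mono hsub).intervalIntegrable_deriv
    refine ⟨hxi.prodMk hui, ?_⟩
    rw [intervalIntegral.integral_of_le hst, integral_pair hxi hui, hxe,
      ← intervalIntegral.integral_of_le hst, (hu.mono hsub).integral_deriv_eq_sub]
    rfl
  have hKc := isClosed_timeEpigraph hUlsc
  have hendK : triple T (Z T).1 (Z T).2 ∈ timeEpigraph T U :=
    triple_mem_timeEpigraph.2 ⟨⟨hT.le, le_rfl⟩, hend⟩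
  have hcurve : ContinuousOn (fun t => triple t (Z t).1 (Z t).2) (Set.Icc t₀ T) :=
    continuous_triple.comp_continuousOn (continuousOn_id.prodMk hZc)
  have hpos : ∀ t₁ ∈ Set.Ioc t₀ T, triple t₁ (Z t₁).1 (Z t₁).2 ∈ timeEpigraph T U := by
    intro t₁ ht₁
    have hsub : Set.Icc t₁ T ⊆ Set.Icc t₀ T := Set.Icc_subset_Icc_left ht₁.1.le
    have key : ∀ j : ℕ, ∃ z : RN n × ℝ,
        Metric.infDist (triple t₁ z.1 z.2) (timeEpigraph T U) ≤ 1 / ((j : ℝ) + 1) ∧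
          ‖z - Z t₁‖ ≤ 1 / ((j : ℝ) + 1) := fun j =>
      exists_near_timeEpigraph hL1 hL2 hL3 hL6 hUproper hUlsc hUnormal (ht₀.1.trans_lt ht₁.1)
        ht₁.2 (hZc.mono hsub) (hZint t₁ ⟨ht₁.1.le, ht₁.2⟩ T ⟨ht₀.2.le, le_rfl⟩ ht₁.2).1
        (fun s hs t ht hst => (hZint s (hsub hs) t (hsub ht) hst).2)
        (ae_restrict_of_ae_restrict_of_subset (Set.Ioc_subset_Icc_self.trans hsub) hZQ) hendK
        (by positivity) ((div_le_one (by positivity)).2 (by linarith [j.cast_nonneg (α := ℝ)]))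
    choose z hzK hzZ using key
    have hlim : Tendsto (fun j : ℕ => 1 / ((j : ℝ) + 1)) atTop (𝓝 0) :=
      tendsto_one_div_add_atTop_nhds_zero_nat
    have hz : Tendsto z atTop (𝓝 (Z t₁)) :=
      tendsto_iff_norm_sub_tendsto_zero.2 (squeeze_zero (fun _ => norm_nonneg _) hzZ hlim)
    have htr : Tendsto (fun j => triple t₁ (z j).1 (z j).2) atTop
        (𝓝 (triple t₁ (Z t₁).1 (Z t₁).2)) :=
      (continuous_triple.tendsto (t₁, Z t₁)).comp (tendsto_const_nhds.prodMk_nhds hz)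
    have h0 := tendsto_nhds_unique (((Metric.continuous_infDist_pt _).tendsto _).comp htr)
      (squeeze_zero (fun _ => Metric.infDist_nonneg) hzK hlim)
    exact (hKc.mem_iff_infDist_zero ⟨_, hendK⟩).2 h0
  have hall : Set.Icc t₀ T ⊆ {t | triple t (Z t).1 (Z t).2 ∈ timeEpigraph T U} := by
    intro t ht
    rcases ht.1.eq_or_lt with rfl | h
    · have htend := (hcurve t₀ ht).mono_left (nhdsWithin_mono _ Set.Ioc_subset_Icc_self)
      have : (𝓝[Set.Ioc t₀ T] t₀).NeBot := by
        rw [nhdsWithin_Ioc_eq_nhdsGT ht₀.2]; infer_instance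
      exact hKc.mem_of_tendsto htend (eventually_nhdsWithin_of_forall hpos)
    · exact hpos t ⟨h, ht.2⟩
  exact fun t ht => (triple_mem_timeEpigraph.1 (hall ht)).2
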